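/- Let $X$ be a first countable Hausdorff space. A subset $S\subseteq X$ is called a nontrivial convergent sequence in $X$ if $S$ is countably infinite and there is a point $x\in S$ such that $S\setminus U$ is finite for every open set $U\subseteq X$ with $x\in U$. Let $\mathcal{S}_c(X)$ be the set of all nonempty compact subsets of $X$ that are nontrivial convergent sequences in $X$, with (the subspace topology of) the Vietoris topology, which has as a base the sets $$\Big\{S\in\mathcal{S}_c(X) : S\subseteq \bigcup\mathcal{U}\ \text{ and }\ S\cap U\neq\emptyset \text{ for all } U\in\mathcal{U}\Big\},$$ where $\mathcal{U}$ ranges over the finite families of open subsets of $X$. A space is called locally pathwise connected if each of its points has a neighborhood basis consisting of pathwise connected (not necessarily open) neighborhoods. Suppose that $\mathcal{S}_c(X)$ is nonempty. Then the following conditions are equivalent: (i) $X$ is locally pathwise connected; (ii) $\mathcal{S}_c(X)$ is locally pathwise connected. -/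

import Mathlib

open TopologicalSpace

/-- A subset `S` of `X` is a nontrivial convergent sequence in `X` if it is countably infinite and
has a point `x ∈ S` (its limit) such that every open set containing `x` contains all but finitely
many points of `S`. -/
def IsNontrivialConvergentSeq {X : Type*} [TopologicalSpace X] (S : Set X) : Prop :=
  S.Countable ∧ S.Infinite ∧ ∃ x ∈ S, ∀ U : Set X, IsOpen U → x ∈ U → (S \ U).Finite

/-- The hyperspace `S_c(X)` of all nontrivial convergent sequences in `X`, as a subset of the
hyperspace of all nonempty compact subsets of `X`. Mathlib equips `NonemptyCompacts X` with the
Vietoris topology, and `S_c(X)` gets the subspace topology. In a Hausdorff space, compact sets are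
closed, so that closedness need not be required separately. -/
def ConvergentSeqHyperspace (X : Type*) [TopologicalSpace X] : Set (NonemptyCompacts X) :=
  {S | IsNontrivialConvergentSeq (S : Set X)}

/-! From hyperspace to `X`: a path of convergent sequences has a continuous selection through any
point of its initial value (`exists_continuous_selection`). So if `S` and `T` are joined among
sequences contained in `U`, every point of `S` is joined in `U` to some point of `T`. If the path
component `C` of `x` in `U` is not a neighbourhood of `x`, choose `y n` outside `C` converging to
`x`. Either some `y n` has a nontrivial component, which contains a convergent sequence `L` disjoint
from `C`, and lifting paths from `L ∪ {x}` to nearby `L ∪ {y}` makes `C` a neighbourhood after all;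
or each `y n` is its own component, and deleting one point from `{x} ∪ {y n}` gives a contradiction.
From `X` to hyperspace: Vietoris sets built from finitely many path connected open sets are path
connected. One sequence collapses to a finite set while the other grows out of a finite set; the
union stays infinite throughout, and an auxiliary finite set `G` absorbs the finite remnants and
keeps every required open set met. -/

open Set Filter Topology unitInterval

/-! ### Continuous selections for paths of compact sets -/

section Lifting

variable {X : Type*} [TopologicalSpace X]

/-- Two disjoint open sets that cover all the values of a set-valued map over a closed interval. -/
structure IntervalSplitting (K : I → NonemptyCompacts X) where
  left : I
  right : I
  fst : Set X
  snd : Set X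
  isOpen_fst : IsOpen fst
  isOpen_snd : IsOpen snd
  disjoint : Disjoint fst snd
  subset_union : ∀ t ∈ Icc left right, (K t : Set X) ⊆ fst ∪ snd

/-- A section does not switch between the two parts of a splitting up to the time `τ`. -/
def IntervalSplitting.Respects {K : I → NonemptyCompacts X} (c : IntervalSplitting K) (τ : I)
    (s : I → X) : Prop :=
  ∀ t ∈ Icc c.left c.right, ∀ t' ∈ Icc c.left c.right, t ≤ τ → t' ≤ τ → s t ∈ c.fst → s t' ∈ c.fst

/-- Connectedness of `[a, b]`: let `G` be the intersection of the sides containing `x` and `H` the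
union of the opposite sides. The times when `K r` meets `G` and those when `K r ⊆ H` form disjoint
open sets covering `[a, b]`, and `a` is of the first kind. -/
theorem IntervalSplitting.exists_mem_same_side {K : I → NonemptyCompacts X} (hK : Continuous K)
    (u : Set (IntervalSplitting K)) (hfin : u.Finite) {a b : I}
    (hu : ∀ c ∈ u, c.left ≤ a ∧ b ≤ c.right) {x : X} (hx : x ∈ K a) (t : I) (ht : t ∈ Icc a b) :
    ∃ y ∈ K t, ∀ c ∈ u, (y ∈ c.fst ↔ x ∈ c.fst) := by
  classical
  let G : Set X := ⋂ c ∈ u, if x ∈ c.fst then c.fst else c.snd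
  let H : Set X := ⋃ c ∈ u, if x ∈ c.fst then c.snd else c.fst
  have hG : IsOpen G := hfin.isOpen_biInter fun c _ => by
    split_ifs
    exacts [c.isOpen_fst, c.isOpen_snd]
  have hH : IsOpen H := isOpen_biUnion fun c _ => by
    split_ifs
    exacts [c.isOpen_snd, c.isOpen_fst]
  have hcov : ∀ r ∈ Icc a b, ∀ y ∈ K r, y ∉ H → y ∈ G := by
    intro r hr y hy hyH
    simp only [G, H, mem_iInter, mem_iUnion, not_exists] at hyH ⊢
    intro c hc
    have h1 := c.subset_union r ⟨(hu c hc).1.trans hr.1, hr.2.trans (hu c hc).2⟩ hy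
    have h2 := hyH c hc
    split_ifs at h2 ⊢
    · exact h1.resolve_right h2
    · exact h1.resolve_left h2
  have hdisj : ∀ y ∈ G, y ∉ H := by
    intro y hy hyH
    simp only [G, H, mem_iInter, mem_iUnion] at hy hyH
    obtain ⟨c, hc, h⟩ := hyH
    have h2 := hy c hc
    split_ifs at h h2
    · exact disjoint_left.1 c.disjoint h2 h
    · exact disjoint_left.1 c.disjoint h h2
  have hsub : Icc a b ⊆ {r | ((K r : Set X) ∩ G).Nonempty} := by
    refine isPreconnected_Icc.subset_left_of_subset_union
      (v := {r | (K r : Set X) ⊆ H})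
      ((NonemptyCompacts.isOpen_inter_nonempty_of_isOpen hG).preimage hK)
      ((NonemptyCompacts.isOpen_subsets_of_isOpen hH).preimage hK) ?_ ?_ ?_
    · rw [disjoint_left]
      rintro r ⟨y, hy, hyG⟩ hr
      exact hdisj y hyG (hr hy)
    · intro r hr
      by_cases h : (K r : Set X) ⊆ H
      · exact Or.inr h
      · obtain ⟨y, hy, hyH⟩ := not_subset.1 h
        exact Or.inl ⟨y, hy, hcov r hr y hy hyH⟩
    · refine ⟨a, ⟨le_rfl, ht.1.trans ht.2⟩, x, hx, ?_⟩
      simp only [G, mem_iInter]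
      intro c hc
      have h1 := c.subset_union a ⟨(hu c hc).1, (ht.1.trans ht.2).trans (hu c hc).2⟩ hx
      split_ifs with h
      · exact h
      · exact h1.resolve_left h
  obtain ⟨y, hy, hyG⟩ := hsub ht
  refine ⟨y, hy, fun c hc => ?_⟩
  simp only [G, mem_iInter] at hyG
  have h := hyG c hc
  split_ifs at h with hxc
  · exact ⟨fun _ => hxc, fun _ => h⟩
  · exact ⟨fun h' => (disjoint_left.1 c.disjoint h' h).elim, fun h' => (hxc h').elim⟩

/-- Induction on the number of interval endpoints below `τ`. From the last such endpoint `a` to `τ`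
the relevant splittings do not change, so the section extends by choosing points on the same sides
as its value at `a`. -/
theorem IntervalSplitting.exists_section_respects {K : I → NonemptyCompacts X} (hK : Continuous K)
    (u : Finset (IntervalSplitting K)) {p : X} (hp : p ∈ K 0) (τ : I) :
    ∃ s : I → X, (∀ t, s t ∈ K t) ∧ s 0 = p ∧ ∀ c ∈ u, c.Respects τ s := by
  classical
  -- Including `0` guarantees an endpoint below every `τ > 0`.
  let E : Finset I := insert 0 (u.image left ∪ u.image right)
  have hEl : ∀ c ∈ u, c.left ∈ E := fun c hc => by
    simp only [E, Finset.mem_insert, Finset.mem_union, Finset.mem_image]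
    exact Or.inr (Or.inl ⟨c, hc, rfl⟩)
  have hEr : ∀ c ∈ u, c.right ∈ E := fun c hc => by
    simp only [E, Finset.mem_insert, Finset.mem_union, Finset.mem_image]
    exact Or.inr (Or.inr ⟨c, hc, rfl⟩)
  induction hn : (E.filter (· < τ)).card using Nat.strong_induction_on generalizing τ with
  | _ n ih =>
  rcases eq_or_lt_of_le (unitInterval.nonneg' (t := τ)) with h0 | h0
  · choose s hs using fun t => (K t).nonempty
    refine ⟨Function.update s 0 p, fun t => ?_, by simp, fun c _ t _ t' _ h h' => ?_⟩
    · by_cases ht : t = 0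
      · subst ht; simpa using hp
      · simpa [ht] using hs t
    · rw [← h0] at h h'
      rw [le_antisymm h unitInterval.nonneg', le_antisymm h' unitInterval.nonneg']
      exact id
  have hne : (E.filter (· < τ)).Nonempty := ⟨0, by simp [E, h0]⟩
  set a := (E.filter (· < τ)).max' hne with ha
  have haE : a ∈ E.filter (· < τ) := Finset.max'_mem _ _
  have haτ : a < τ := (Finset.mem_filter.1 haE).2
  have hmax : ∀ e ∈ E, e < τ → e ≤ a := fun e he h =>
    Finset.le_max' _ _ (Finset.mem_filter.2 ⟨he, h⟩)
  have hcard : (E.filter (· < a)).card < n := by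
    rw [← hn]
    refine Finset.card_lt_card ⟨fun e he => ?_, fun h => ?_⟩
    · rw [Finset.mem_filter] at he ⊢
      exact ⟨he.1, he.2.trans haτ⟩
    · exact lt_irrefl a (Finset.mem_filter.1 (h haE)).2
  obtain ⟨s, hs, hs0, hsu⟩ := ih _ hcard a rfl
  have hext := IntervalSplitting.exists_mem_same_side hK
    {c | c ∈ u ∧ c.left ≤ a ∧ τ ≤ c.right} (u.finite_toSet.subset fun c hc => hc.1)
    (fun c hc => hc.2) (hs a)
  have : Nonempty X := ⟨p⟩
  choose! y hyK hy using hext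
  refine ⟨fun t => if t ∈ Ioc a τ then y t else s t, fun t => ?_, ?_, fun c hc => ?_⟩
  · dsimp only
    split_ifs with h
    · exact hyK t ⟨h.1.le, h.2⟩
    · exact hs t
  · have : (0 : I) ∉ Ioc a τ := fun h => not_lt_of_ge unitInterval.nonneg' h.1
    simp only [this, if_false, hs0]
  by_cases hact : c.left ≤ a ∧ τ ≤ c.right
  · have key : ∀ t ∈ Icc c.left c.right, t ≤ τ →
        ((if t ∈ Ioc a τ then y t else s t) ∈ c.fst ↔ s a ∈ c.fst) := by
      intro t ht htτ
      have haI : a ∈ Icc c.left c.right := ⟨hact.1, haτ.le.trans hact.2⟩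
      split_ifs with h
      · exact hy t ⟨h.1.le, h.2⟩ c ⟨hc, hact⟩
      · have hta : t ≤ a := not_lt.1 fun h' => h ⟨h', htτ⟩
        exact ⟨hsu c hc t ht a haI hta le_rfl, hsu c hc a haI t ht le_rfl hta⟩
    intro t ht t' ht' h h' hm
    exact (key t' ht' h').2 ((key t ht h).1 hm)
  -- If `c` does not span `[a, τ]`, two distinct times of its interval up to `τ` both lie before or
  -- at `a`; otherwise an endpoint of `c` would fall strictly between `a` and `τ`. The old section
  -- then suffices.
  · have key : ∀ t ∈ Icc c.left c.right, ∀ t' ∈ Icc c.left c.right, t < t' → t' ≤ τ → t' ≤ a := by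
      intro t ht t' ht' htt h'
      by_contra hlt
      rw [not_le] at hlt
      refine hact ⟨hmax _ (hEl c hc) (ht.1.trans_lt (htt.trans_le h')), ?_⟩
      by_contra hr
      exact absurd (hmax _ (hEr c hc) (not_le.1 hr)) (not_le.2 (hlt.trans_le ht'.2))
    intro t ht t' ht' h h'
    have hold : ∀ r ≤ a, (if r ∈ Ioc a τ then y r else s r) = s r := fun r hr =>
      if_neg fun hr' => not_lt_of_ge hr hr'.1
    dsimp only
    rcases lt_trichotomy t t' with hlt | rfl | hlt
    · have h2 := key t ht t' ht' hlt h'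
      rw [hold t (hlt.le.trans h2), hold t' h2]
      exact hsu c hc t ht t' ht' (hlt.le.trans h2) h2
    · exact id
    · have h2 := key t' ht' t ht hlt h
      rw [hold t' (hlt.le.trans h2), hold t h2]
      exact hsu c hc t ht t' ht' h2 (hlt.le.trans h2)

/-- A continuous map from the unit interval to a hyperspace of compact sets, all of whose values
can be split into small clopen pieces, has a continuous selection through each point of its initial
value. -/
theorem exists_continuous_selection [T2Space X] {K : I → NonemptyCompacts X} (hK : Continuous K)
    (hsplit : ∀ t, ∀ q ∈ K t, ∀ O : Set X, IsOpen O → q ∈ O → ∃ O₁ O₂ : Set X, IsOpen O₁ ∧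
      IsOpen O₂ ∧ Disjoint O₁ O₂ ∧ q ∈ O₁ ∧ O₁ ⊆ O ∧ (K t : Set X) ⊆ O₁ ∪ O₂)
    {p : X} (hp : p ∈ K 0) :
    ∃ s : I → X, Continuous s ∧ s 0 = p ∧ ∀ t, s t ∈ K t := by
  -- Sections that avoid one of the two parts throughout the interval. This condition is closed in
  -- the product topology, so Tychonoff yields one section that respects all splittings at once.
  let Z : IntervalSplitting K → Set (I → X) := fun c =>
    (⋂ t ∈ Icc c.left c.right, {s | s t ∈ c.sndᶜ}) ∪ ⋂ t ∈ Icc c.left c.right, {s | s t ∈ c.fstᶜ}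
  have hZ : ∀ c, IsClosed (Z c) := fun c =>
    (isClosed_biInter fun t _ => c.isOpen_snd.isClosed_compl.preimage (continuous_apply t)).union
      (isClosed_biInter fun t _ => c.isOpen_fst.isClosed_compl.preimage (continuous_apply t))
  have hcomp : IsCompact (univ.pi (fun t => (K t : Set X)) ∩ {s | s 0 = p}) :=
    (isCompact_univ_pi fun t => (K t).isCompact).inter_right
      (isClosed_singleton.preimage (continuous_apply 0))
  obtain ⟨s, ⟨hsK, hs0⟩, hsZ⟩ := hcomp.inter_iInter_nonempty Z hZ fun u => by
    obtain ⟨s, hs, hs0, hsu⟩ := IntervalSplitting.exists_section_respects hK u hp 1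
    refine ⟨s, ⟨fun t _ => hs t, hs0⟩, mem_iInter₂.2 fun c hc => ?_⟩
    by_cases h : ∃ t ∈ Icc c.left c.right, s t ∈ c.fst
    · obtain ⟨t, ht, hst⟩ := h
      refine Or.inl (mem_iInter₂.2 fun r hr => ?_)
      exact disjoint_left.1 c.disjoint
        (hsu c hc t ht r hr unitInterval.le_one' unitInterval.le_one' hst)
    · push Not at h
      exact Or.inr (mem_iInter₂.2 fun r hr => h r hr)
  replace hsK : ∀ t, s t ∈ K t := fun t => hsK t (mem_univ t)
  refine ⟨s, continuous_iff_continuousAt.2 fun t => ?_, hs0, hsK⟩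
  rw [ContinuousAt, (nhds_basis_opens (s t)).tendsto_right_iff]
  rintro O ⟨hqO, hO⟩
  obtain ⟨O₁, O₂, h₁, h₂, hd, hq, hsub, hcov⟩ := hsplit t (s t) (hsK t) O hO hqO
  have hev : ∀ᶠ r in 𝓝 t, (K r : Set X) ⊆ O₁ ∪ O₂ :=
    ((NonemptyCompacts.isOpen_subsets_of_isOpen (h₁.union h₂)).preimage hK).mem_nhds hcov
  obtain ⟨a, b, htab, hab, habs⟩ := exists_Icc_mem_subset_of_mem_nhds hev
  -- Near `t` the splitting of `K t` still splits `K r`. Since `s t` lies in `O₁`, the section is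
  -- confined to `O₁ ⊆ O` there, which is continuity at `t`.
  let c : IntervalSplitting K := ⟨a, b, O₁, O₂, h₁, h₂, hd, fun r hr => habs hr⟩
  filter_upwards [hab] with r hr
  rcases mem_iInter.1 hsZ c with h | h
  · exact hsub ((habs hr (hsK r)).resolve_right (mem_iInter₂.1 h r hr))
  · exact (mem_iInter₂.1 h t htab hq).elim

end Lifting

/-! ### Compactness and clopen splittings of convergent sequences -/

section ConvergentSequences

variable {X : Type*} [TopologicalSpace X]

/-- An ultrafilter on `A` that does not converge to `z` contains a finite set `A \ U`. -/
theorem isCompact_of_forall_diff_finite {A : Set X} {z : X} (hz : z ∈ A)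
    (h : ∀ U : Set X, IsOpen U → z ∈ U → (A \ U).Finite) : IsCompact A := by
  rw [isCompact_iff_ultrafilter_le_nhds]
  intro f hf
  by_cases hfz : (f : Filter X) ≤ 𝓝 z
  · exact ⟨z, hz, hfz⟩
  · obtain ⟨U, ⟨hzU, hU⟩, hUf⟩ : ∃ U : Set X, (z ∈ U ∧ IsOpen U) ∧ U ∉ f := by
      by_contra! hcon
      exact hfz ((nhds_basis_opens z).ge_iff.2 fun U hU => hcon U hU)
    have hmem : A \ U ∈ f :=
      inter_mem (le_principal_iff.1 hf) (Ultrafilter.compl_mem_iff_notMem.2 hUf)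
    obtain ⟨a, ha, hfa⟩ := (h U hU hzU).isCompact.ultrafilter_le_nhds f (le_principal_iff.2 hmem)
    exact ⟨a, ha.1, hfa⟩

theorem IsNontrivialConvergentSeq.isCompact {S : Set X} (hS : IsNontrivialConvergentSeq S) :
    IsCompact S := by
  obtain ⟨-, -, z, hz, h⟩ := hS
  exact isCompact_of_forall_diff_finite hz h

theorem IsNontrivialConvergentSeq.union_finite {S F : Set X} (hS : IsNontrivialConvergentSeq S)
    (hF : F.Finite) : IsNontrivialConvergentSeq (S ∪ F) := by
  obtain ⟨hc, hi, z, hz, h⟩ := hS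
  refine ⟨hc.union hF.countable, hi.mono subset_union_left, z, Or.inl hz, fun U hU hzU => ?_⟩
  rw [union_sdiff_distrib]
  exact (h U hU hzU).union (hF.subset sdiff_subset)

theorem isNontrivialConvergentSeq_of_subset {S T : Set X} {z : X}
    (hc : S.Countable) (h : ∀ U : Set X, IsOpen U → z ∈ U → (S \ U).Finite) (hTS : T ⊆ S)
    (hz : z ∈ T) (hT : T.Infinite) : IsNontrivialConvergentSeq T :=
  ⟨hc.mono hTS, hT, z, hz, fun U hU hzU => (h U hU hzU).subset (sdiff_subset_sdiff_left hTS)⟩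

theorem finite_insert_range_diff {y : ℕ → X} {z : X} (hy : Tendsto y atTop (𝓝 z)) {U : Set X}
    (hU : IsOpen U) (hz : z ∈ U) : (insert z (range y) \ U).Finite := by
  have hev : {n | y n ∉ U}.Finite := by
    have := hy.eventually (hU.mem_nhds hz)
    rw [← Nat.cofinite_eq_atTop, eventually_cofinite] at this
    exact this
  refine (hev.image y).subset ?_
  rintro x ⟨rfl | ⟨n, rfl⟩, hx⟩
  · exact (hx hz).elim
  · exact ⟨n, hx, rfl⟩

theorem infinite_range_of_tendsto_of_ne [T1Space X] {y : ℕ → X} {z : X}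
    (hy : Tendsto y atTop (𝓝 z)) (hne : ∀ n, y n ≠ z) : (range y).Infinite := by
  intro hfin
  have h : (range y)ᶜ ∈ 𝓝 z := hfin.isClosed.isOpen_compl.mem_nhds fun ⟨n, hn⟩ => hne n hn
  obtain ⟨n, hn⟩ := (hy.eventually h).exists
  exact hn ⟨n, rfl⟩

theorem isNontrivialConvergentSeq_insert_range [T1Space X] {y : ℕ → X} {z : X}
    (hy : Tendsto y atTop (𝓝 z)) (hne : ∀ n, y n ≠ z) :
    IsNontrivialConvergentSeq (insert z (range y)) :=
  ⟨(countable_range y).insert z,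
    (infinite_range_of_tendsto_of_ne hy hne).mono (subset_insert z (range y)), z, mem_insert _ _,
    fun _ hU hz => finite_insert_range_diff hy hU hz⟩

theorem exists_isNontrivialConvergentSeq_subset [T1Space X] [FirstCountableTopology X]
    {D : Set X} {z : X} (hz : z ∈ D) (h : ∃ᶠ y in 𝓝[≠] z, y ∈ D) :
    ∃ L ⊆ D, IsNontrivialConvergentSeq L := by
  obtain ⟨y, hy, hyD⟩ := exists_seq_forall_of_frequently
    (h.and_eventually (eventually_mem_nhdsWithin (a := z) (s := {z}ᶜ)))
  refine ⟨insert z (range y), insert_subset hz (range_subset_iff.2 fun n => (hyD n).1),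
    isNontrivialConvergentSeq_insert_range (hy.mono_right nhdsWithin_le_nhds) fun n => (hyD n).2⟩

/-- A nontrivial convergent sequence as a point of the hyperspace of nonempty compact sets. -/
def IsNontrivialConvergentSeq.toNonemptyCompacts {S : Set X} (hS : IsNontrivialConvergentSeq S) :
    NonemptyCompacts X :=
  ⟨⟨S, hS.isCompact⟩, hS.2.1.nonempty⟩

/-- Convergent sequences are zero-dimensional: cut off `S ∩ O` if `q` is the limit, and `{q}`
otherwise. Both pieces are compact, hence separated by open sets. -/
theorem IsNontrivialConvergentSeq.exists_splitting [T2Space X] {S : Set X}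
    (hS : IsNontrivialConvergentSeq S) {q : X} (hq : q ∈ S) {O : Set X} (hO : IsOpen O)
    (hqO : q ∈ O) : ∃ O₁ O₂ : Set X, IsOpen O₁ ∧ IsOpen O₂ ∧ Disjoint O₁ O₂ ∧ q ∈ O₁ ∧ O₁ ⊆ O ∧
      S ⊆ O₁ ∪ O₂ := by
  suffices h : ∃ C ⊆ S, q ∈ C ∧ C ⊆ O ∧ IsCompact C ∧ IsCompact (S \ C) by
    obtain ⟨C, -, hqC, hCO, hC, hSC⟩ := h
    obtain ⟨U, V, hU, hV, hCU, hSV, hd⟩ :=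
      SeparatedNhds.of_isCompact_isCompact hC hSC disjoint_sdiff_right
    refine ⟨U ∩ O, V, hU.inter hO, hV, hd.mono_left inter_subset_left, ⟨hCU hqC, hqO⟩,
      inter_subset_right, fun x hx => ?_⟩
    by_cases hxC : x ∈ C
    · exact Or.inl ⟨hCU hxC, hCO hxC⟩
    · exact Or.inr (hSV ⟨hx, hxC⟩)
  obtain ⟨-, -, z, hz, h⟩ := hS
  by_cases hqz : q = z
  · subst hqz
    refine ⟨S ∩ O, inter_subset_left, ⟨hq, hqO⟩, inter_subset_right,
      isCompact_of_forall_diff_finite ⟨hq, hqO⟩ fun U hU hqU =>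
        (h U hU hqU).subset (sdiff_subset_sdiff_left inter_subset_left), ?_⟩
    rw [sdiff_self_inter]
    exact (h O hO hqO).isCompact
  · exact ⟨{q}, singleton_subset_iff.2 hq, rfl, singleton_subset_iff.2 hqO, isCompact_singleton,
      isCompact_of_forall_diff_finite ⟨hz, fun h => hqz h.symm⟩ fun U hU hzU =>
        (h U hU hzU).subset (sdiff_subset_sdiff_left sdiff_subset)⟩

theorem exists_joinedIn_of_joinedIn_hyperspace [T2Space X] {U : Set X}
    {S T : ConvergentSeqHyperspace X}
    (h : JoinedIn {K : ConvergentSeqHyperspace X | ((K : NonemptyCompacts X) : Set X) ⊆ U} S T)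
    {p : X} (hp : p ∈ (S : NonemptyCompacts X)) :
    ∃ q ∈ (T : NonemptyCompacts X), JoinedIn U p q := by
  obtain ⟨γ, hγ⟩ := h
  obtain ⟨s, hs, hs0, hsK⟩ := exists_continuous_selection
    (K := fun t => (γ t : NonemptyCompacts X)) (continuous_subtype_val.comp γ.continuous)
    (fun t q hq O hO hqO => (γ t).2.exists_splitting hq hO hqO) (p := p) (by simpa using hp)
  refine ⟨s 1, by simpa using hsK 1, ⟨⟨⟨s, hs⟩, hs0, rfl⟩, fun t => hγ t (hsK t)⟩⟩

end ConvergentSequences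

/-! ### Local path connectedness descends to the space -/

section LocallyPathConnectedOfHyperspace

variable {X : Type*} [TopologicalSpace X]

theorem exists_nhds_joinedIn_hyperspace [LocallyPathConnectedSpace (ConvergentSeqHyperspace X)]
    {U : Set X} (hU : IsOpen U) (S : ConvergentSeqHyperspace X)
    (hS : ((S : NonemptyCompacts X) : Set X) ⊆ U) :
    ∀ᶠ T in 𝓝 S, JoinedIn
      {K : ConvergentSeqHyperspace X | ((K : NonemptyCompacts X) : Set X) ⊆ U} S T := by
  refine pathComponentIn_mem_nhds (IsOpen.mem_nhds ?_ hS)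
  exact (NonemptyCompacts.isOpen_subsets_of_isOpen hU).preimage continuous_subtype_val

/-- A connected T1 set with more than one point has no isolated points. -/
theorem frequently_mem_of_joinedIn [T2Space X] {U : Set X} {x y : X} (h : JoinedIn U x y)
    (hne : x ≠ y) : ∃ᶠ z in 𝓝[≠] x, z ∈ pathComponentIn U x := by
  have hpc : IsPathConnected (pathComponentIn U x) :=
    isPathConnected_pathComponentIn h.source_mem
  have hx : x ∈ pathComponentIn U x := mem_pathComponentIn_self h.source_mem
  have hacc := hpc.isConnected.isPreconnected.preperfect_of_nontrivial ⟨x, hx, y, h, hne⟩ x hx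
  exact accPt_iff_frequently_nhdsNE.1 hacc

/-- The map `y ↦ L ∪ {y}` is continuous, so for `y` near `x` a path in the hyperspace over `U` joins
`L ∪ {x}` to `L ∪ {y}`. Its lift from `x` cannot end in `L`, so it ends at `y`. -/
theorem pathComponentIn_mem_nhds_of_disjoint [T2Space X]
    [LocallyPathConnectedSpace (ConvergentSeqHyperspace X)] {U : Set X} (hU : IsOpen U) {x : X}
    (hx : x ∈ U) {L : Set X} (hL : IsNontrivialConvergentSeq L) (hLU : L ⊆ U)
    (hd : Disjoint L (pathComponentIn U x)) : pathComponentIn U x ∈ 𝓝 x := by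
  let f : X → ConvergentSeqHyperspace X := fun y =>
    ⟨hL.toNonemptyCompacts ⊔ {y}, by
      change IsNontrivialConvergentSeq (L ∪ {y})
      exact hL.union_finite (finite_singleton y)⟩
  have hf : Continuous f := by
    refine Continuous.subtype_mk ?_ _
    exact continuous_const.sup NonemptyCompacts.continuous_singleton
  have hfx : ((f x : NonemptyCompacts X) : Set X) ⊆ U :=
    union_subset hLU (singleton_subset_iff.2 hx)
  filter_upwards [hf.continuousAt.eventually (exists_nhds_joinedIn_hyperspace hU (f x) hfx)]
    with y hy
  obtain ⟨q, hq, hjq⟩ := exists_joinedIn_of_joinedIn_hyperspace hy (p := x) (Or.inr rfl)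
  rcases hq with hq | hq
  · exact (disjoint_left.1 hd hq hjq).elim
  · rwa [← show q = y from hq]

/-- Each fixed point of `S` is deleted for only finitely many `n`, so an open set that meets `S`
eventually meets `T n`. -/
theorem tendsto_hyperspace_diff_singleton [T1Space X] {y : ℕ → X} {x : X}
    (hy : Tendsto y atTop (𝓝 x)) (hne : ∀ n, y n ≠ x)
    (T : ℕ → NonemptyCompacts X) (S : NonemptyCompacts X)
    (hT : ∀ n, (T n : Set X) = (S : Set X) \ {y n}) :
    Tendsto T atTop (𝓝 S) := by
  let _ : TopologicalSpace (Set X) := TopologicalSpace.vietoris X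
  rw [NonemptyCompacts.isEmbedding_coe.tendsto_nhds_iff]
  refine tendsto_nhds_generateFrom_iff.2 ?_
  rintro _ (⟨U, hU, rfl⟩ | ⟨U, hU, rfl⟩) hS
  · refine Eventually.of_forall fun n => ?_
    change (T n : Set X) ⊆ U
    rw [hT]
    exact sdiff_subset.trans hS
  · obtain ⟨v, hvS, hvU⟩ := hS
    have hev : ∀ᶠ n in atTop, y n ≠ v := by
      by_cases hvx : v = x
      · exact Eventually.of_forall fun n => hvx ▸ hne n
      · exact hy.eventually_ne (Ne.symm hvx)
    filter_upwards [hev] with n hn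
    refine ⟨v, ?_, hvU⟩
    simp only [Function.comp_apply, hT]
    exact ⟨hvS, hn.symm⟩

theorem locallyPathConnectedSpace_of_hyperspace [T2Space X] [FirstCountableTopology X]
    [LocallyPathConnectedSpace (ConvergentSeqHyperspace X)] : LocallyPathConnectedSpace X := by
  rw [locallyPathConnectedSpace_iff_pathComponentIn_mem_nhds]
  intro x U hU hx
  by_contra hC
  have hfr : ∃ᶠ y in 𝓝 x, y ∉ pathComponentIn U x := fun h =>
    hC (by filter_upwards [h] with y hy using not_not.1 hy)
  obtain ⟨y, hyx, hy⟩ := exists_seq_forall_of_frequently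
    (hfr.and_eventually (hU.mem_nhds hx))
  have hne : ∀ n, y n ≠ x := fun n h => (hy n).1 (by rw [h]; exact mem_pathComponentIn_self hx)
  by_cases hsing : ∃ n d, d ≠ y n ∧ JoinedIn U (y n) d
  · obtain ⟨n, d, hd, hj⟩ := hsing
    obtain ⟨L, hLD, hL⟩ := exists_isNontrivialConvergentSeq_subset
      (mem_pathComponentIn_self (hy n).2) (frequently_mem_of_joinedIn hj hd.symm)
    refine hC (pathComponentIn_mem_nhds_of_disjoint hU hx hL (hLD.trans pathComponentIn_subset) ?_)
    refine disjoint_left.2 fun l hl hlx => (hy n).1 ?_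
    exact JoinedIn.trans hlx (hLD hl).symm
  · push Not at hsing
    have hS : IsNontrivialConvergentSeq (insert x (range y)) :=
      isNontrivialConvergentSeq_insert_range hyx hne
    have hT : ∀ n, IsNontrivialConvergentSeq (insert x (range y) \ {y n}) := fun n =>
      isNontrivialConvergentSeq_of_subset hS.1
        (fun V hV hxV => finite_insert_range_diff hyx hV hxV) sdiff_subset
        ⟨mem_insert _ _, (hne n).symm⟩ (hS.2.1.sdiff (finite_singleton _))
    let S : ConvergentSeqHyperspace X := ⟨hS.toNonemptyCompacts, hS⟩
    let T : ℕ → ConvergentSeqHyperspace X := fun n => ⟨(hT n).toNonemptyCompacts, hT n⟩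
    have hTS : Tendsto T atTop (𝓝 S) := tendsto_subtype_rng.2
      (tendsto_hyperspace_diff_singleton hyx hne _ _ fun n => rfl)
    have hSU : ((S : NonemptyCompacts X) : Set X) ⊆ U :=
      insert_subset hx (range_subset_iff.2 fun n => (hy n).2)
    -- Lifting from the deleted point `y n` ends in `S \ {y n}`, so `y n` is joined to a point other
    -- than itself.
    obtain ⟨n, hn⟩ := (hTS.eventually (exists_nhds_joinedIn_hyperspace hU S hSU)).exists
    obtain ⟨q, hq, hj⟩ := exists_joinedIn_of_joinedIn_hyperspace hn (p := y n)
      (Or.inr ⟨n, rfl⟩)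
    by_cases hqn : q = y n
    · exact hq.2 hqn
    · exact hsing n q hqn hj

end LocallyPathConnectedOfHyperspace

/-! ### Paths of convergent sequences in a locally path connected space -/

section HyperspacePaths

variable {X : Type*} [TopologicalSpace X]

/-- A sequence of paths that converges uniformly to a point gives a path of convergent sequences in
the hyperspace of compact sets. -/
theorem exists_continuous_coe_eq_insert_range {g : ℕ → I → X} {z : X}
    (hg : ∀ k, Continuous (g k)) (hgz : ∀ U ∈ 𝓝 z, ∀ᶠ k in atTop, ∀ t, g k t ∈ U) :
    ∃ A : I → NonemptyCompacts X, Continuous A ∧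
      ∀ t, (A t : Set X) = insert z (range fun k => g k t) := by
  have hlim : ∀ t, Tendsto (fun k => g k t) atTop (𝓝 z) := fun t U hU =>
    (hgz U hU).mono fun k hk => hk t
  refine ⟨fun t => ⟨⟨insert z (range fun k => g k t), (hlim t).isCompact_insert_range⟩,
    insert_nonempty _ _⟩, ?_, fun t => rfl⟩
  let _ : TopologicalSpace (Set X) := TopologicalSpace.vietoris X
  rw [continuous_induced_rng, continuous_generateFrom_iff]
  rintro _ (⟨U, hU, rfl⟩ | ⟨U, hU, rfl⟩)
  · change IsOpen {t | insert z (range fun k => g k t) ⊆ U}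
    by_cases hz : z ∈ U
    · obtain ⟨N, hN⟩ := eventually_atTop.1 (hgz U (hU.mem_nhds hz))
      have : {t | insert z (range fun k => g k t) ⊆ U} = ⋂ k ∈ Finset.range N, g k ⁻¹' U := by
        ext t
        simp only [mem_ofPred_eq, insert_subset_iff, range_subset_iff, mem_iInter,
          Finset.mem_range, mem_preimage]
        refine ⟨fun h k _ => h.2 k, fun h => ⟨hz, fun k => ?_⟩⟩
        by_cases hk : k < N
        · exact h k hk
        · exact hN k (not_lt.1 hk) t
      rw [this]
      exact isOpen_biInter_finset fun k _ => hU.preimage (hg k)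
    · convert! isOpen_empty
      exact eq_empty_of_forall_notMem fun t ht => hz (ht (mem_insert _ _))
  · change IsOpen {t | (insert z (range fun k => g k t) ∩ U).Nonempty}
    by_cases hz : z ∈ U
    · convert! isOpen_univ
      exact eq_univ_of_forall fun t => ⟨z, mem_insert _ _, hz⟩
    · have : {t | (insert z (range fun k => g k t) ∩ U).Nonempty} = ⋃ k, g k ⁻¹' U := by
        ext t
        simp only [mem_ofPred_eq, mem_iUnion, mem_preimage]
        constructor
        · rintro ⟨x, rfl | ⟨k, rfl⟩, hx⟩
          · exact (hz hx).elim
          · exact ⟨k, hx⟩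
        · rintro ⟨k, hk⟩
          exact ⟨g k t, Or.inr ⟨k, rfl⟩, hk⟩
      rw [this]
      exact isOpen_iUnion fun k => hU.preimage (hg k)

/-- The path runs inside the deepest `Q m` with `m ≤ N` that contains `x`; outside `Q 0` it is
constant. -/
theorem exists_path_mem_basis {Q : ℕ → Set X} (hanti : Antitone Q)
    (hpc : ∀ n, IsPathConnected (Q n)) {z : X} (hz : ∀ n, z ∈ Q n) {W : Set X} (hQW : Q 0 ⊆ W)
    {x : X} (hx : x ∈ W) (N : ℕ) :
    ∃ g : I → X, Continuous g ∧ g 0 = x ∧ (x ∈ Q 0 → g 1 = z) ∧ (∀ t, g t ∈ W) ∧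
      ∀ n ≤ N, x ∈ Q n → ∀ t, g t ∈ Q n := by
  classical
  by_cases hx0 : x ∈ Q 0
  · have hm : x ∈ Q (Nat.findGreatest (fun n => x ∈ Q n) N) :=
      Nat.findGreatest_spec (P := fun n => x ∈ Q n) (Nat.zero_le N) hx0
    obtain ⟨γ, hγ⟩ := (hpc _).joinedIn x hm z (hz _)
    refine ⟨γ, γ.continuous, γ.source, fun _ => γ.target,
      fun t => hQW (hanti (Nat.zero_le _) (hγ t)), fun n hn hxn t => ?_⟩
    exact hanti (Nat.le_findGreatest hn hxn) (hγ t)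
  · exact ⟨fun _ => x, continuous_const, rfl, fun h => (hx0 h).elim, fun _ => hx,
      fun n _ hxn => (hx0 (hanti (Nat.zero_le n) hxn)).elim⟩

/-- All but finitely many points of a nontrivial convergent sequence can be moved to its limit along
paths that converge uniformly to the limit. -/
theorem IsNontrivialConvergentSeq.exists_contraction [FirstCountableTopology X]
    [LocallyPathConnectedSpace X] {S : Set X} (hS : IsNontrivialConvergentSeq S) {W : Set X}
    (hW : IsOpen W) (hSW : S ⊆ W) :
    ∃ z ∈ S, ∃ h : ℕ → I → X, (∀ k, Continuous (h k)) ∧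
      (∀ U ∈ 𝓝 z, ∀ᶠ k in atTop, ∀ t, h k t ∈ U) ∧ (Function.Injective fun k => h k 0) ∧
      insert z (range fun k => h k 0) = S ∧ (∀ᶠ k in atTop, h k 1 = z) ∧ ∀ k t, h k t ∈ W := by
  obtain ⟨hc, hi, z, hz, hlim⟩ := hS
  have : Countable ↥(S \ {z}) := (hc.mono sdiff_subset).to_subtype
  have : Infinite ↥(S \ {z}) := (hi.sdiff (finite_singleton z)).to_subtype
  obtain ⟨e⟩ : Nonempty (ℕ ≃ ↥(S \ {z})) := by
    obtain ⟨_⟩ := nonempty_denumerable ↥(S \ {z})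
    exact ⟨(Denumerable.eqv _).symm⟩
  have hev : ∀ U : Set X, U ∈ 𝓝 z → ∀ᶠ k in atTop, (e k : X) ∈ U := by
    intro U hU
    obtain ⟨V, hVU, hV, hzV⟩ := mem_nhds_iff.1 hU
    have hfin : {k | (e k : X) ∉ V}.Finite :=
      Set.Finite.of_finite_image ((hlim V hV hzV).subset (by
        rintro _ ⟨k, hk, rfl⟩
        exact ⟨(e k).2.1, hk⟩)) (Subtype.val_injective.comp e.injective).injOn
    rw [← Nat.cofinite_eq_atTop, eventually_cofinite]
    exact hfin.subset fun k hk hkV => hk (hVU hkV)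
  obtain ⟨Q, hQ, hQb⟩ := (pathConnected_subset_basis hW (hSW hz)).exists_antitone_subbasis
  -- The depth bound for the `k`-th point is `k`, so it eventually exceeds any fixed `n`; this gives
  -- uniform convergence of the paths.
  choose g hg hg0 hg1 hgW hgQ using fun k => exists_path_mem_basis hQb.antitone
    (fun n => (hQ n).2.1) (fun n => mem_of_mem_nhds (hQ n).1) (hQ 0).2.2 (hSW (e k).2.1) k
  refine ⟨z, hz, g, hg, fun U hU => ?_, ?_, ?_, ?_, hgW⟩
  · obtain ⟨n, -, hn⟩ := hQb.toHasBasis.mem_iff.1 hU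
    filter_upwards [eventually_ge_atTop n, hev (Q n) (hQ n).1] with k hk hkQ t
    exact hn (hgQ k n hk hkQ t)
  · simp only [hg0]
    exact Subtype.val_injective.comp e.injective
  · simp only [hg0]
    have : (range fun k => (e k : X)) = S \ {z} := by
      rw [show (fun k => (e k : X)) = Subtype.val ∘ e from rfl, range_comp, e.range_eq_univ,
        image_univ, Subtype.range_coe]
    rw [this, insert_sdiff_singleton, insert_eq_of_mem hz]
  · filter_upwards [hev (Q 0) (hQ 0).1] with k hk using hg1 k hk

/-- Reparametrizations of the unit interval that vanish ever longer and end at `1`. -/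
noncomputable def delay (k : ℕ) (t : I) : I :=
  projIcc 0 1 zero_le_one (1 - ((k : ℝ) + 1) * (1 - (t : ℝ)))

theorem continuous_delay (k : ℕ) : Continuous (delay k) := by
  unfold delay
  exact continuous_projIcc.comp (by fun_prop)

theorem delay_one (k : ℕ) : delay k 1 = 1 := by
  simp [delay]

theorem delay_zero (k : ℕ) : delay k 0 = 0 := by
  have h : (1 - ((k : ℝ) + 1) * (1 - ((0 : I) : ℝ))) ≤ 0 := by simp
  exact projIcc_of_le_left zero_le_one h

theorem eventually_delay_eq_zero {t : I} (ht : t ≠ 1) : ∀ᶠ k in atTop, delay k t = 0 := by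
  have ht' : 0 < 1 - (t : ℝ) :=
    sub_pos.2 (lt_of_le_of_ne t.2.2 fun h => ht (Subtype.ext h))
  obtain ⟨n, hn⟩ := exists_nat_gt (1 / (1 - (t : ℝ)))
  filter_upwards [eventually_ge_atTop n] with k hk
  have hk' : (n : ℝ) ≤ k := by exact_mod_cast hk
  have h : 1 - ((k : ℝ) + 1) * (1 - (t : ℝ)) ≤ 0 := by
    rw [div_lt_iff₀ ht'] at hn
    nlinarith
  exact projIcc_of_le_left zero_le_one h

/-- The `k`-th point follows its contraction delayed by `delay k`. Before time `1` all but finitely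
many points have not moved, so the set is infinite; at time `1` all but finitely many have reached
the limit. -/
theorem IsNontrivialConvergentSeq.exists_shrinking_path [FirstCountableTopology X]
    [LocallyPathConnectedSpace X] {S : Set X} (hS : IsNontrivialConvergentSeq S) {W : Set X}
    (hW : IsOpen W) (hSW : S ⊆ W) :
    ∃ A : I → NonemptyCompacts X, Continuous A ∧ (A 0 : Set X) = S ∧ (A 1 : Set X).Finite ∧
      (∀ t, (A t : Set X) ⊆ W) ∧ ∀ t ≠ 1, IsNontrivialConvergentSeq (A t : Set X) := by
  obtain ⟨z, hz, h, hc, hu, hinj, hS0, h1, hhW⟩ := hS.exists_contraction hW hSW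
  obtain ⟨A, hA, hAeq⟩ := exists_continuous_coe_eq_insert_range (z := z)
    (g := fun k t => h k (delay k t)) (fun k => (hc k).comp (continuous_delay k))
    (fun U hU => (hu U hU).mono fun k hk t => hk _)
  have hlim : ∀ t, Tendsto (fun k => h k (delay k t)) atTop (𝓝 z) := fun t U hU =>
    (hu U hU).mono fun k hk => hk _
  refine ⟨A, hA, by simp only [hAeq, delay_zero, hS0], ?_, fun t => ?_, fun t ht => ?_⟩
  · obtain ⟨N, hN⟩ := eventually_atTop.1 h1
    rw [hAeq]
    refine (((finite_Iio N).image fun k => h k 1).insert z).subset ?_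
    rintro _ (rfl | ⟨k, rfl⟩)
    · exact mem_insert _ _
    · simp only [delay_one]
      by_cases hk : k < N
      · exact Or.inr ⟨k, hk, rfl⟩
      · exact Or.inl (hN k (not_lt.1 hk))
  · rw [hAeq]
    exact insert_subset (hSW hz) (range_subset_iff.2 fun k => hhW k _)
  · rw [hAeq]
    refine ⟨(countable_range _).insert z, ?_, z, mem_insert _ _, fun U hU hzU =>
      finite_insert_range_diff (hlim t) hU hzU⟩
    obtain ⟨N, hN⟩ := eventually_atTop.1 (eventually_delay_eq_zero ht)
    refine ((Ici_infinite N).image hinj.injOn).mono ?_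
    rintro _ ⟨k, hk, rfl⟩
    exact Or.inr ⟨k, by simp only [hN k hk]⟩

/-- The delayed contractions are run backwards: before time `1` all but finitely many points still
sit at the limit. -/
theorem IsNontrivialConvergentSeq.exists_growing_path [FirstCountableTopology X]
    [LocallyPathConnectedSpace X] {S : Set X} (hS : IsNontrivialConvergentSeq S) {W : Set X}
    (hW : IsOpen W) (hSW : S ⊆ W) :
    ∃ B : I → NonemptyCompacts X, Continuous B ∧ (B 1 : Set X) = S ∧
      (∀ t, (B t : Set X) ⊆ W) ∧ ∀ t ≠ 1, (B t : Set X).Finite := by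
  obtain ⟨z, hz, h, hc, hu, -, hS0, h1, hhW⟩ := hS.exists_contraction hW hSW
  obtain ⟨B, hB, hBeq⟩ := exists_continuous_coe_eq_insert_range (z := z)
    (g := fun k t => h k (σ (delay k t)))
    (fun k => (hc k).comp (continuous_symm.comp (continuous_delay k)))
    (fun U hU => (hu U hU).mono fun k hk t => hk _)
  refine ⟨B, hB, by simp only [hBeq, delay_one, symm_one, hS0], fun t => ?_, fun t ht => ?_⟩
  · rw [hBeq]
    exact insert_subset (hSW hz) (range_subset_iff.2 fun k => hhW k _)
  · obtain ⟨N, hN⟩ := eventually_atTop.1 (h1.and (eventually_delay_eq_zero ht))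
    rw [hBeq]
    refine (((finite_Iio N).image fun k => h k (σ (delay k t))).insert z).subset ?_
    rintro _ (rfl | ⟨k, rfl⟩)
    · exact mem_insert _ _
    · by_cases hk : k < N
      · exact Or.inr ⟨k, hk, rfl⟩
      · refine Or.inl ?_
        obtain ⟨h1k, h0k⟩ := hN k (not_lt.1 hk)
        simp only [h0k, symm_zero, h1k]

/-- Two nontrivial convergent sequences become joined in the hyperspace once a suitable finite set
has been added to both of them. -/
theorem IsNontrivialConvergentSeq.exists_finite_joinedIn_union [FirstCountableTopology X]
    [LocallyPathConnectedSpace X] {S T : Set X} (hS : IsNontrivialConvergentSeq S)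
    (hT : IsNontrivialConvergentSeq T) {W : Set X} (hW : IsOpen W) (hSW : S ⊆ W) (hTW : T ⊆ W) :
    ∃ F ⊆ W, F.Finite ∧ ∀ G : Set X, (hG : G.Finite) → F ⊆ G → G ⊆ W →
      JoinedIn {K : NonemptyCompacts X | IsNontrivialConvergentSeq (K : Set X) ∧
          (K : Set X) ⊆ W ∧ G ⊆ K}
        (hS.union_finite hG).toNonemptyCompacts (hT.union_finite hG).toNonemptyCompacts := by
  obtain ⟨A, hA, hA0, hA1, hAW, hAi⟩ := hS.exists_shrinking_path hW hSW
  obtain ⟨B, hB, hB1, hBW, hBf⟩ := hT.exists_growing_path hW hTW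
  refine ⟨(A 1 : Set X) ∪ B 0, union_subset (hAW 1) (hBW 0),
    hA1.union (hBf 0 zero_ne_one), fun G hG hFG hGW => ?_⟩
  have hGne : G.Nonempty := ((A 1).nonempty.mono subset_union_left).mono hFG
  let G' : NonemptyCompacts X := ⟨⟨G, hG.isCompact⟩, hGne⟩
  have hcoe : ∀ t, ((A t ⊔ B t ⊔ G' : NonemptyCompacts X) : Set X) =
      (A t : Set X) ∪ B t ∪ G := fun t => rfl
  -- `G` swallows `B 0` at the start and `A 1` at the end. Before time `1` the part `A t` keeps the
  -- union infinite; at time `1` the part `B 1 = T` does.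
  refine ⟨⟨⟨fun t => A t ⊔ B t ⊔ G', (hA.sup hB).sup continuous_const⟩, ?_, ?_⟩, fun t => ?_⟩
  · refine NonemptyCompacts.ext ?_
    change ((A 0 ⊔ B 0 ⊔ G' : NonemptyCompacts X) : Set X) = S ∪ G
    rw [hcoe, hA0, union_assoc, union_eq_right.2 (subset_union_right.trans hFG)]
  · refine NonemptyCompacts.ext ?_
    change ((A 1 ⊔ B 1 ⊔ G' : NonemptyCompacts X) : Set X) = T ∪ G
    rw [hcoe, hB1, union_comm (A 1 : Set X), union_assoc,
      union_eq_right.2 (subset_union_left.trans hFG)]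
  · change IsNontrivialConvergentSeq ((A t : Set X) ∪ B t ∪ G) ∧
      (A t : Set X) ∪ B t ∪ G ⊆ W ∧ G ⊆ (A t : Set X) ∪ B t ∪ G
    refine ⟨?_, union_subset (union_subset (hAW t) (hBW t)) hGW, subset_union_right⟩
    by_cases ht : t = 1
    · subst ht
      rw [hB1, union_comm (A 1 : Set X)]
      exact (hT.union_finite hA1).union_finite hG
    · exact ((hAi t ht).union_finite (hBf t ht)).union_finite hG

/-- Each new point `e ∈ U` is grown out of a point of `T ∩ U` by moving an extra point along a path
in `U`, while `T` stays in place. -/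
theorem joinedIn_union_finite {u : Set (Set X)} (hu : ∀ U ∈ u, IsPathConnected U)
    {T : Set X} (hT : IsNontrivialConvergentSeq T) (hTu : T ⊆ ⋃₀ u)
    (hTU : ∀ U ∈ u, (T ∩ U).Nonempty) {G : Set X} (hG : G.Finite) (hGu : G ⊆ ⋃₀ u) :
    JoinedIn ({K : NonemptyCompacts X | (K : Set X) ⊆ ⋃₀ u ∧ ∀ U ∈ u, ((K : Set X) ∩ U).Nonempty} ∩
        ConvergentSeqHyperspace X)
      hT.toNonemptyCompacts (hT.union_finite hG).toNonemptyCompacts := by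
  induction G, hG using Set.Finite.induction_on with
  | empty =>
    have : (hT.union_finite finite_empty).toNonemptyCompacts = hT.toNonemptyCompacts :=
      NonemptyCompacts.ext (union_empty T)
    rw [this]
    exact JoinedIn.refl ⟨⟨hTu, hTU⟩, hT⟩
  | @insert e G he hGf ih =>
    obtain ⟨heu, hGu'⟩ := insert_subset_iff.1 hGu
    refine (ih hGu').trans ?_
    obtain ⟨U, hU, heU⟩ := heu
    obtain ⟨q, hqT, hqU⟩ := hTU U hU
    obtain ⟨γ, hγ⟩ := (hu U hU).joinedIn q hqU e heU
    have hTG := hT.union_finite hGf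
    refine ⟨⟨⟨fun t => hTG.toNonemptyCompacts ⊔ {γ t}, continuous_const.sup
      (NonemptyCompacts.continuous_singleton.comp γ.continuous)⟩, ?_, ?_⟩, fun t => ?_⟩
    · refine NonemptyCompacts.ext ?_
      change T ∪ G ∪ {γ 0} = T ∪ G
      rw [γ.source, union_eq_left]
      exact singleton_subset_iff.2 (Or.inl hqT)
    · refine NonemptyCompacts.ext ?_
      change T ∪ G ∪ {γ 1} = T ∪ insert e G
      rw [γ.target, union_assoc, union_singleton]
    · change ((T ∪ G ∪ {γ t} ⊆ ⋃₀ u) ∧ ∀ U ∈ u, ((T ∪ G ∪ {γ t}) ∩ U).Nonempty) ∧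
        IsNontrivialConvergentSeq (T ∪ G ∪ {γ t})
      refine ⟨⟨union_subset (union_subset hTu hGu')
        (singleton_subset_iff.2 ⟨U, hU, hγ t⟩), fun V hV => (hTU V hV).mono ?_⟩,
        hTG.union_finite (finite_singleton _)⟩
      exact inter_subset_inter_left V (subset_union_left.trans subset_union_left)

theorem isPathConnected_vietoris_inter_hyperspace [FirstCountableTopology X]
    [LocallyPathConnectedSpace X] {u : Set (Set X)} (hfin : u.Finite)
    (hu : ∀ U ∈ u, IsOpen U ∧ IsPathConnected U) {S : NonemptyCompacts X}
    (hS : S ∈ {K : NonemptyCompacts X | (K : Set X) ⊆ ⋃₀ u ∧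
      ∀ U ∈ u, ((K : Set X) ∩ U).Nonempty} ∩ ConvergentSeqHyperspace X) :
    IsPathConnected ({K : NonemptyCompacts X | (K : Set X) ⊆ ⋃₀ u ∧
      ∀ U ∈ u, ((K : Set X) ∩ U).Nonempty} ∩ ConvergentSeqHyperspace X) := by
  refine ⟨S, hS, fun {T} hT => ?_⟩
  obtain ⟨⟨hSu, hSU⟩, hS⟩ := hS
  obtain ⟨⟨hTu, hTU⟩, hT⟩ := hT
  change IsNontrivialConvergentSeq (S : Set X) at hS
  change IsNontrivialConvergentSeq (T : Set X) at hT
  obtain ⟨F, hFW, hF, hj⟩ := hS.exists_finite_joinedIn_union hT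
    (isOpen_sUnion fun U hU => (hu U hU).1) hSu hTu
  have : Nonempty X := S.nonempty.to_type
  choose! r hr using hSU
  -- One point of each member of `u` is added, so that the middle path from `S ∪ G` to `T ∪ G` never
  -- stops meeting any of them.
  have hG : (F ∪ r '' u).Finite := hF.union (hfin.image r)
  have hGu : F ∪ r '' u ⊆ ⋃₀ u := union_subset hFW (image_subset_iff.2 fun U hU =>
    ⟨U, hU, (hr U hU).2⟩)
  have h1 := joinedIn_union_finite (fun U hU => (hu U hU).2) hS hSu
    (fun U hU => ⟨r U, hr U hU⟩) hG hGu
  have h2 := joinedIn_union_finite (fun U hU => (hu U hU).2) hT hTu hTU hG hGu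
  refine (h1.trans ((hj _ hG subset_union_left hGu).mono ?_)).trans h2.symm
  rintro K ⟨hK, hKW, hGK⟩
  exact ⟨⟨hKW, fun U hU => ⟨r U, hGK (Or.inr ⟨U, hU, rfl⟩), (hr U hU).2⟩⟩, hK⟩

theorem locallyPathConnectedSpace_hyperspace [FirstCountableTopology X]
    [LocallyPathConnectedSpace X] : LocallyPathConnectedSpace (ConvergentSeqHyperspace X) := by
  have hB : IsTopologicalBasis {U : Set X | IsOpen U ∧ IsPathConnected U} :=
    isTopologicalBasis_of_isOpen_of_nhds (fun U hU => hU.1) fun x U hx hU => by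
      obtain ⟨V, ⟨hV, hxV, hVpc⟩, hVU⟩ := (isOpen_isPathConnected_basis x).mem_iff.1
        (hU.mem_nhds hx)
      exact ⟨V, ⟨hV, hVpc⟩, hxV, hVU⟩
  refine ⟨fun S => hasBasis_self.2 fun N hN => ?_⟩
  obtain ⟨N', hN', hNN'⟩ := mem_nhds_subtype _ _ _ |>.1 hN
  obtain ⟨_, ⟨u, ⟨hfin, hne, hu⟩, rfl⟩, hSu, huN⟩ := hB.nonemptyCompacts.mem_nhds_iff.1 hN'
  have hopen := hB.nonemptyCompacts.isOpen ⟨u, ⟨hfin, hne, hu⟩, rfl⟩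
  have hpc := isPathConnected_vietoris_inter_hyperspace hfin hu ⟨hSu, S.2⟩
  refine ⟨_, (hopen.preimage continuous_subtype_val).mem_nhds hSu, ?_,
    (preimage_mono huN).trans hNN'⟩
  rw [← Subtype.preimage_coe_inter_self]
  exact hpc.preimage_coe inter_subset_right

end HyperspacePaths

theorem mainTheorem4 (X : Type*) [TopologicalSpace X] [T2Space X] [FirstCountableTopology X]
    (hne : (ConvergentSeqHyperspace X).Nonempty) :
    LocallyPathConnectedSpace X ↔ LocallyPathConnectedSpace (ConvergentSeqHyperspace X) :=
  ⟨fun _ => locallyPathConnectedSpace_hyperspace, fun _ => locallyPathConnectedSpace_of_hyperspace⟩
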